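/- Let $\Sigma$ be a finite set of real (or complex) numbers with $-\Sigma=\Sigma$, and let $\mathrm{rank}_{\mathbb Q}(\Sigma)$ be the dimension of the $\mathbb Q$-linear span of $\Sigma$, i.e. the maximum size of a subset of $\Sigma$ that is linearly independent over $\mathbb Q$. Let $\psi$ be a symmetric ($\psi(\{-d\})=\psi(\{d\})$ for all $d$), zero-mean, non-degenerate probability distribution on $\Sigma$; non-degenerate means that $\psi$ is not a point mass and that the points of $\Sigma$ of positive $\psi$-probability have the same $\mathbb Q$-linear span as $\Sigma$ (this holds, e.g., if every point of $\Sigma\neq\{0\}$ has positive probability). An $N\times K$ matrix $H$ is called detecting for a set $\mathcal S$ if, for all $x_1,x_2\in\mathcal S^K$, $Hx_1=Hx_2$ implies $x_1=x_2$; for a two-point set $\mathcal S=\{a,b\}$, $a\ne b$, this says that no nonzero $x\in\{\pm1,0\}^K$ lies in the null space of $H$. Let $(K_n)$ and $(N_n)$ be sequences of natural numbers with $K_n\to\infty$ and $N_n\to\infty$ such that, for some constant $c<\mathrm{rank}_{\mathbb Q}(\Sigma)/2$, $$\zeta_n=\frac{K_n}{N_n\log_3 K_n}\le c\qquad\text{for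 all sufficiently large } n ,$$ and for each $n$ let $H_n$ be a random $N_n\times K_n$ matrix with i.i.d. entries of distribution $\psi$, all $H_n$ being defined on one probability space (with arbitrary dependence between different $n$). Then the probability that $H_n$ is detecting for every binary input set $\{a,b\}$, $a\neq b$, tends to $1$ as $n\to\infty$. If moreover the sizes $(K_n,N_n)$ are pairwise distinct (for instance $K_n=n$), then almost surely $H_n$ is, for all sufficiently large $n$, detecting for every binary input set $\{a,b\}$, $a\neq b$. -/

import Mathlib

open MeasureTheory ProbabilityTheory Filter Topology

/-- An `m × n` matrix `H` is *detecting* for the input set `S` if two vectors with all entries in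
`S` that have the same image under `H` coincide. -/
def IsDetecting {R m n : Type*} [NonUnitalNonAssocSemiring R] [Fintype n]
    (S : Set R) (H : Matrix m n R) : Prop :=
  ∀ x₁ x₂ : n → R, (∀ i, x₁ i ∈ S) → (∀ i, x₂ i ∈ S) → H.mulVec x₁ = H.mulVec x₂ → x₁ = x₂

/-- The dimension over `ℚ` of (the rational span of) a finite set of numbers. -/
noncomputable def rationalRank {𝕜 : Type*} [RCLike 𝕜] (D : Finset 𝕜) : ℕ :=
  Module.finrank ℚ (Submodule.span ℚ (D : Set 𝕜))

/-- `ψ` is a symmetric, zero-mean, non-degenerate probability distribution on the finite set `D`.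
Non-degenerate means that `ψ` is not a point mass and that it is not concentrated on a proper
rational subspace of the rational span of `D`. -/
structure IsSymmetricNondegenerateOn {𝕜 : Type*} [RCLike 𝕜] (ψ : Measure 𝕜) (D : Finset 𝕜) :
    Prop where
  isProbabilityMeasure : IsProbabilityMeasure ψ
  concentrated : ψ ((D : Set 𝕜)ᶜ) = 0
  symmetric : ∀ d : 𝕜, ψ {-d} = ψ {d}
  zero_mean : ∫ d, d ∂ψ = 0
  not_point_mass : ∀ d : 𝕜, ψ {d} ≠ 1
  span_atoms : Submodule.span ℚ {d : 𝕜 | d ∈ D ∧ ψ {d} ≠ 0} = Submodule.span ℚ (D : Set 𝕜)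

/-- The entries of the random matrix `H` are independent and identically distributed with
distribution `ψ`. -/
structure HasIIDEntries {𝕜 m n Ω : Type*} [RCLike 𝕜] [MeasurableSpace Ω]
    (H : Ω → Matrix m n 𝕜) (ψ : Measure 𝕜) (μ : Measure Ω) : Prop where
  hasLaw : ∀ i j, HasLaw (fun ω => H ω i j) ψ μ
  indep : iIndepFun (fun (p : m × n) (ω : Ω) => H ω p.1 p.2) μ

/-! A failure of detection for any pair `a ≠ b` gives a nonzero vector with entries in {0, ±1} in
the null space, so a union bound over such vectors serves all pairs at once. By symmetry of `ψ` and
independence of the rows, a vector with support of size k lies in the null space with probability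
p_k ^ N, where p_k is the probability that k independent entries sum to 0. It remains to bound the
sum over k of C(K,k) 2^k p_k ^ N.

Two estimates of p_k suffice: p_k ≤ ρ < 1 for k ≥ 1, and p_k² ≤ B (k+1)^(-r) with r the rational
rank. For the second, view `ψ` as an element of the real group algebra, so that convolution is
multiplication, and split off small two-point masses at ±b_j for r independent atoms b_j. In the
multinomial expansion the r directions do not interact, each giving a factor m_j^(-1/2), and
typically m_j is of order k.

With 2c/r < σ < 1, supports of size at most K^σ are few enough for the first estimate. For larger
ones C(K,k) 2^k ≤ 3^K ≤ K^(cN) is beaten by the second, since rσ/2 > c. The resulting bound is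
summable over pairs (K, N), and Borel–Cantelli gives the almost sure statement. -/

/-! ### Convolution powers as powers in the group algebra -/

section GroupAlgebra

open AddMonoidAlgebra Finset

variable {G : Type*} [AddCommGroup G]

theorem coeff_sum_single_mul (D : Finset G) (w : G → ℝ) (g : AddMonoidAlgebra ℝ G) (v : G) :
    coeff ((∑ d ∈ D, single d (w d)) * g) v = ∑ d ∈ D, w d * coeff g (v - d) := by
  rw [Finset.sum_mul]
  simp [coeff_sum, coeff_single_mul_apply, Finsupp.finsetSum_apply, sub_eq_neg_add]

/-- Convolving with a nonnegative measure preserves nonnegativity and scales the largest coefficient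
by at most the total mass. -/
theorem coeff_sum_single_pow_mul_mem_Icc {D : Finset G} {w : G → ℝ} (hw : ∀ d ∈ D, 0 ≤ w d)
    {g : AddMonoidAlgebra ℝ G} {M : ℝ} (hg : ∀ v, coeff g v ∈ Set.Icc 0 M) (n : ℕ) (v : G) :
    coeff ((∑ d ∈ D, single d (w d)) ^ n * g) v ∈ Set.Icc 0 ((∑ d ∈ D, w d) ^ n * M) := by
  induction n generalizing v with
  | zero => simpa using hg v
  | succ n ih =>
    rw [pow_succ' (∑ d ∈ D, single d (w d)), mul_assoc, coeff_sum_single_mul, pow_succ' (∑ d ∈ D, w d),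
      mul_assoc, Finset.sum_mul]
    exact ⟨Finset.sum_nonneg fun d hd => mul_nonneg (hw d hd) (ih _).1,
      Finset.sum_le_sum fun d hd => mul_le_mul_of_nonneg_left (ih _).2 (hw d hd)⟩

theorem coeff_sum_single_pow_le {D : Finset G} {w : G → ℝ} (hw : ∀ d ∈ D, 0 ≤ w d)
    (hsum : ∑ d ∈ D, w d = 1) {ρ : ℝ} (hρ0 : 0 ≤ ρ) (hρ : ∀ d ∈ D, w d ≤ ρ) {n : ℕ} (hn : 1 ≤ n)
    (v : G) : coeff ((∑ d ∈ D, single d (w d)) ^ n) v ≤ ρ := by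
  classical
  obtain ⟨n, rfl⟩ := Nat.exists_eq_add_of_le' hn
  have h := (coeff_sum_single_pow_mul_mem_Icc (M := ρ) hw (g := ∑ d ∈ D, single d (w d)) ?_ n v).2
  · simpa [pow_succ, hsum] using h
  · intro u
    have : coeff (∑ d ∈ D, single d (w d)) u = if u ∈ D then w u else 0 := by
      simp [coeff_sum, Finsupp.finsetSum_apply, Finsupp.single_apply]
    rw [this]
    split_ifs with h
    · exact ⟨hw u h, hρ u h⟩
    · exact ⟨le_rfl, hρ0⟩

/-- Even case: the recursion for `centralBinom` and (2m+1)(2m+3) ≤ 4(m+1)². The odd case follows, as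
the next central coefficient is twice the middle one. -/
theorem Nat.choose_half_sq_mul_succ_le (n : ℕ) : (n.choose (n / 2)) ^ 2 * (n + 1) ≤ 4 ^ n := by
  have key : ∀ m : ℕ, m.centralBinom ^ 2 * (2 * m + 1) ≤ 4 ^ (2 * m) := by
    intro m
    induction m with
    | zero => simp
    | succ m ih =>
      have h := Nat.succ_mul_centralBinom_succ m
      have h1 : (m + 1) ^ 2 * ((m + 1).centralBinom ^ 2 * (2 * (m + 1) + 1)) ≤
          (m + 1) ^ 2 * 4 ^ (2 * (m + 1)) := by
        calc (m + 1) ^ 2 * ((m + 1).centralBinom ^ 2 * (2 * (m + 1) + 1))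
            = ((m + 1) * (m + 1).centralBinom) ^ 2 * (2 * m + 3) := by ring
          _ = (m.centralBinom ^ 2 * (2 * m + 1)) * (4 * ((2 * m + 1) * (2 * m + 3))) := by
            rw [h]; ring
          _ ≤ 4 ^ (2 * m) * (4 * (4 * (m + 1) ^ 2)) := by
            refine Nat.mul_le_mul ih (Nat.mul_le_mul_left _ ?_)
            nlinarith
          _ = (m + 1) ^ 2 * 4 ^ (2 * (m + 1)) := by ring
      exact Nat.le_of_mul_le_mul_left h1 (by positivity)
  rcases Nat.even_or_odd' n with ⟨m, rfl | rfl⟩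
  · simpa [Nat.centralBinom_eq_two_mul_choose] using key m
  · have h := key (m + 1)
    have h2 : (m + 1).centralBinom = 2 * (2 * m + 1).choose m := by
      rw [Nat.centralBinom_eq_two_mul_choose, show 2 * (m + 1) = (2 * m + 1) + 1 by ring,
        Nat.choose_succ_succ', ← Nat.choose_symm_half m]
      ring
    have h3 : (2 * m + 1) / 2 = m := by omega
    rw [h3]
    rw [h2] at h
    have h4 : 4 * (((2 * m + 1).choose m) ^ 2 * (2 * m + 1 + 1)) ≤ 4 * 4 ^ (2 * m + 1) := by
      calc _ ≤ (2 * (2 * m + 1).choose m) ^ 2 * (2 * (m + 1) + 1) := by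
            nlinarith [sq_nonneg ((2 * m + 1).choose m)]
        _ ≤ _ := h
        _ = _ := by ring
    omega

theorem choose_div_two_pow_le (n i : ℕ) :
    (n.choose i : ℝ) / 2 ^ n ≤ (Real.sqrt (n + 1))⁻¹ := by
  have h : ((n.choose i : ℝ)) ^ 2 * (n + 1) ≤ (2 ^ n) ^ 2 := by
    have h1 := Nat.choose_half_sq_mul_succ_le n
    have h2 := Nat.choose_le_middle i n
    have h3 : (n.choose i) ^ 2 * (n + 1) ≤ 4 ^ n := le_trans (by gcongr) h1
    calc ((n.choose i : ℝ)) ^ 2 * (n + 1) ≤ 4 ^ n := by exact_mod_cast h3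
      _ = (2 ^ n) ^ 2 := by rw [← pow_mul, mul_comm, pow_mul]; norm_num
  rw [div_le_iff₀ (by positivity), inv_mul_eq_div, le_div_iff₀ (by positivity)]
  apply le_of_sq_le_sq _ (by positivity)
  rw [mul_pow, Real.sq_sqrt (by positivity)]
  exact h

/-- The coefficients of a product of powers of symmetric two-point elements along
linearly independent directions are at most the product of the largest coefficients. -/
theorem coeff_prod_two_point_pow_mem_Icc [Module ℚ G] {ι : Type*} [Fintype ι] {b : ι → G}
    (hb : LinearIndependent ℚ b) {ε : ℝ} (hε : 0 ≤ ε) (m : ι → ℕ) (v : G) :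
    coeff (∏ j, (single (b j) ε + single (-b j) ε : AddMonoidAlgebra ℝ G) ^ m j) v ∈
      Set.Icc 0 (∏ j, ((2 * ε) ^ m j * (Real.sqrt (m j + 1))⁻¹)) := by
  classical
  have h1 : ∀ j, (single (b j) ε + single (-b j) ε : AddMonoidAlgebra ℝ G) ^ m j =
      ∑ i ∈ range (m j + 1),
        single (((2 * i : ℚ) - m j) • b j) (ε ^ m j * (m j).choose i) := by
    intro j
    rw [add_pow]
    refine Finset.sum_congr rfl fun i hi => ?_
    have hi' : i ≤ m j := Nat.lt_succ_iff.1 (Finset.mem_range.1 hi)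
    rw [single_pow, single_pow, single_mul_single, ← nsmul_eq_mul', smul_single]
    congr 1
    · rw [← Nat.cast_smul_eq_nsmul ℚ, ← Nat.cast_smul_eq_nsmul ℚ, smul_neg, ← neg_smul, ← add_smul]
      congr 1
      push_cast [hi']
      ring
    · rw [← pow_add, Nat.add_sub_cancel' hi', nsmul_eq_mul, mul_comm]
  have h2 : (∏ j, (single (b j) ε + single (-b j) ε : AddMonoidAlgebra ℝ G) ^ m j) =
      ∑ t ∈ Fintype.piFinset fun j => range (m j + 1),
        single (∑ j, ((2 * (t j) : ℚ) - m j) • b j) (∏ j, (ε ^ m j * (m j).choose (t j))) := by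
    simp_rw [h1]
    rw [Finset.prod_univ_sum]
    refine Finset.sum_congr rfl fun t _ => ?_
    rw [AddMonoidAlgebra.prod_single]
  have hnn : ∀ t : ι → ℕ, 0 ≤ ∏ j, (ε ^ m j * ((m j).choose (t j) : ℝ)) := fun t =>
    Finset.prod_nonneg fun j _ => by positivity
  have hle : ∀ t : ι → ℕ, ∏ j, (ε ^ m j * ((m j).choose (t j) : ℝ)) ≤
      ∏ j, ((2 * ε) ^ m j * (Real.sqrt (m j + 1))⁻¹) := by
    intro t
    refine Finset.prod_le_prod (fun j _ => by positivity) fun j _ => ?_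
    have := choose_div_two_pow_le (m j) (t j)
    rw [div_le_iff₀ (by positivity)] at this
    calc ε ^ m j * ((m j).choose (t j) : ℝ) ≤ ε ^ m j * ((Real.sqrt (m j + 1))⁻¹ * 2 ^ m j) := by
          gcongr
      _ = _ := by rw [mul_pow]; ring
  have hM : 0 ≤ ∏ j, ((2 * ε) ^ m j * (Real.sqrt (m j + 1))⁻¹) :=
    Finset.prod_nonneg fun j _ => by positivity
  -- By independence, different exponent tuples land on different group elements, so at most one
  -- term contributes to each coefficient.
  have hinj : ∀ t t' : ι → ℕ, (∑ j, ((2 * (t j) : ℚ) - m j) • b j) =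
      (∑ j, ((2 * (t' j) : ℚ) - m j) • b j) → t = t' := by
    intro t t' h
    have h3 : ∑ j, (((2 * (t j) : ℚ) - m j) - ((2 * (t' j) : ℚ) - m j)) • b j = 0 := by
      simp_rw [sub_smul _ _ (b _)]
      rw [Finset.sum_sub_distrib, sub_eq_zero]
      simpa only [sub_smul] using h
    funext j
    have := Fintype.linearIndependent_iff.1 hb _ h3 j
    have h4 : (t j : ℚ) = t' j := by linarith
    exact_mod_cast h4
  rw [h2, coeff_sum, Finsupp.finsetSum_apply]
  simp only [coeff_single, Finsupp.single_apply]
  by_cases hv : ∃ t ∈ Fintype.piFinset fun j => range (m j + 1),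
      ∑ j, ((2 * (t j) : ℚ) - m j) • b j = v
  · obtain ⟨t, ht, rfl⟩ := hv
    rw [Finset.sum_eq_single t]
    · simpa using ⟨hnn t, hle t⟩
    · intro t' _ hne
      exact if_neg fun h => hne (hinj _ _ h)
    · exact fun h => absurd ht h
  · push Not at hv
    rw [Finset.sum_eq_zero fun t ht => if_neg (hv t ht)]
    exact ⟨le_rfl, hM⟩

end GroupAlgebra

/-! ### A multinomial moment -/

section Multinomial

open Finset
open scoped Nat

/-- Raising each `k (some j)` by one absorbs the factors 1/(k_j+1) into the multinomial coefficient,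
at the cost of n!/(n+r)! and one factor 1/q_j per j. The shifted terms are distinct terms of (∑
q)^(n+r) = 1. The index `none` is for the remaining mass, which may vanish. -/
theorem sum_multinomial_mul_prod_inv_le {ι : Type*} [Fintype ι] [DecidableEq ι] {q : Option ι → ℝ}
    (hq : ∀ i, 0 ≤ q i) (hq' : ∀ j, 0 < q (some j)) (hsum : ∑ i, q i = 1) (n : ℕ) :
    ∑ k ∈ piAntidiag univ n, (Nat.multinomial univ k : ℝ) * (∏ i, q i ^ k i) *
        ∏ j : ι, ((k (some j) : ℝ) + 1)⁻¹ ≤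
      (∏ j : ι, (q (some j))⁻¹) * ((n : ℝ) + 1)⁻¹ ^ Fintype.card ι := by
  set r := Fintype.card ι with hr
  set e : Option ι → ℕ := fun i => i.elim 0 fun _ => 1 with he
  have hfac : ((n ! : ℕ) : ℝ) / ((n + r)! : ℕ) ≤ ((n : ℝ) + 1)⁻¹ ^ r := by
    rw [div_le_iff₀ (by positivity), inv_pow, inv_mul_eq_div, le_div_iff₀ (by positivity)]
    exact_mod_cast Nat.factorial_mul_pow_le_factorial
  have hP : 0 < ∏ j : ι, q (some j) := Finset.prod_pos fun j _ => hq' j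
  have hterm : ∀ k ∈ piAntidiag (univ : Finset (Option ι)) n,
      (Nat.multinomial univ k : ℝ) * (∏ i, q i ^ k i) * ∏ j : ι, ((k (some j) : ℝ) + 1)⁻¹ =
      (∏ j : ι, (q (some j))⁻¹) * (((n ! : ℕ) : ℝ) / ((n + r)! : ℕ)) *
        ((Nat.multinomial univ (k + e) : ℝ) * ∏ i, q i ^ (k + e) i) := by
    intro k hk
    have hk1 : ∑ i, k i = n := (mem_piAntidiag.1 hk).1
    have hk2 : ∑ i, (k + e) i = n + r := by
      simp [Finset.sum_add_distrib, hk1, he, hr]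
    have s1 : (∏ i, ((k i)! : ℝ)) * Nat.multinomial univ k = (n ! : ℕ) := by
      have := Nat.multinomial_spec univ k
      rw [hk1] at this
      exact_mod_cast this
    have s2 : (∏ i, (((k + e) i)! : ℝ)) * Nat.multinomial univ (k + e) = ((n + r)! : ℕ) := by
      have := Nat.multinomial_spec univ (k + e)
      rw [hk2] at this
      exact_mod_cast this
    have s3 : (∏ i, (((k + e) i)! : ℝ)) =
        (∏ i, ((k i)! : ℝ)) * ∏ j : ι, ((k (some j) : ℝ) + 1) := by
      rw [Fintype.prod_option, Fintype.prod_option, mul_assoc, ← Finset.prod_mul_distrib]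
      simp only [Pi.add_apply, he, Option.elim, add_zero]
      congr 1
      refine Finset.prod_congr rfl fun j _ => ?_
      rw [Nat.factorial_succ]
      push_cast
      ring
    have s4 : (∏ i, q i ^ (k + e) i) = (∏ i, q i ^ k i) * ∏ j : ι, q (some j) := by
      rw [Fintype.prod_option, Fintype.prod_option, mul_assoc, ← Finset.prod_mul_distrib]
      simp only [Pi.add_apply, he, Option.elim, add_zero, pow_succ]
    have p1 : 0 < ∏ i, ((k i)! : ℝ) := Finset.prod_pos fun i _ => by positivity
    have p2 : 0 < ∏ j : ι, ((k (some j) : ℝ) + 1) := Finset.prod_pos fun j _ => by positivity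
    have p3 : (0 : ℝ) < ((n + r)! : ℕ) := by positivity
    rw [s3] at s2
    rw [s4, ← s1, ← s2, Finset.prod_inv_distrib, Finset.prod_inv_distrib]
    have p4 : (Nat.multinomial univ (k + e) : ℝ) ≠ 0 := by
      intro h0
      rw [h0, mul_zero] at s2
      exact p3.ne s2
    field_simp
  have htot : ∑ k ∈ piAntidiag (univ : Finset (Option ι)) n,
      ((Nat.multinomial univ (k + e) : ℝ) * ∏ i, q i ^ (k + e) i) ≤ 1 := by
    calc _ = ∑ k' ∈ (piAntidiag (univ : Finset (Option ι)) n).image (· + e),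
          ((Nat.multinomial univ k' : ℝ) * ∏ i, q i ^ k' i) := by
          rw [Finset.sum_image fun x _ y _ h => add_right_cancel h]
      _ ≤ ∑ k' ∈ piAntidiag (univ : Finset (Option ι)) (n + r),
          ((Nat.multinomial univ k' : ℝ) * ∏ i, q i ^ k' i) := by
          refine Finset.sum_le_sum_of_subset_of_nonneg ?_ fun k' _ _ =>
            mul_nonneg (by positivity) (Finset.prod_nonneg fun i _ => pow_nonneg (hq i) _)
          intro k' hk'
          obtain ⟨k, hk, rfl⟩ := Finset.mem_image.1 hk'
          have hk1 : ∑ i, k i = n := (mem_piAntidiag.1 hk).1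
          simp [mem_piAntidiag, Finset.sum_add_distrib, hk1, he, hr]
      _ = (∑ i, q i) ^ (n + r) := (Finset.sum_pow_eq_sum_piAntidiag _ _ _).symm
      _ = 1 := by rw [hsum, one_pow]
  have hPi : 0 ≤ ∏ j : ι, (q (some j))⁻¹ := Finset.prod_nonneg fun j _ => inv_nonneg.2 (hq _)
  rw [Finset.sum_congr rfl hterm, ← Finset.mul_sum]
  calc _ ≤ (∏ j : ι, (q (some j))⁻¹) * (((n ! : ℕ) : ℝ) / ((n + r)! : ℕ)) * 1 := by
        gcongr
    _ ≤ _ := by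
        rw [mul_one]
        gcongr

end Multinomial

/-! ### Decay of the coefficients of convolution powers -/

section GroupAlgebra

open AddMonoidAlgebra Finset

variable {G : Type*} [AddCommGroup G]

/-- An `n`-fold convolution power of a distribution whose atoms contain `± b j` for linearly
independent vectors `b j` has coefficients of order `n ^ (-r / 2)`. -/
theorem exists_sq_coeff_sum_single_pow_le [Module ℚ G] {ι : Type*} [Fintype ι] {b : ι → G}
    (hb : LinearIndependent ℚ b) {D : Finset G} {w : G → ℝ} (hw : ∀ d ∈ D, 0 ≤ w d)
    (hsum : ∑ d ∈ D, w d = 1) (hbD : ∀ j, b j ∈ D) (hbD' : ∀ j, -b j ∈ D)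
    (hbw : ∀ j, 0 < w (b j)) (hbw' : ∀ j, 0 < w (-b j)) :
    ∃ B : ℝ, ∀ (n : ℕ) (v : G), (coeff ((∑ d ∈ D, single d (w d)) ^ n) v) ^ 2 ≤
      B * ((n : ℝ) + 1)⁻¹ ^ Fintype.card ι := by
  classical
  obtain ⟨δ, hδ, hδb⟩ : ∃ δ > 0, ∀ j, δ ≤ w (b j) ∧ δ ≤ w (-b j) := by
    rcases isEmpty_or_nonempty ι with h | h
    · exact ⟨1, one_pos, fun j => h.elim j⟩
    · obtain ⟨j0, hj0⟩ := Finite.exists_min fun j => min (w (b j)) (w (-b j))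
      exact ⟨_, lt_min (hbw j0) (hbw' j0), fun j => le_min_iff.1 (hj0 j)⟩
  set r := Fintype.card ι with hr
  -- Small enough that even all 2r pieces on one point take at most δ; the +1 covers r = 0.
  set ε : ℝ := δ / (2 * r + 1) with hε
  have hε0 : 0 < ε := by positivity
  have hεr : ε * (2 * r) ≤ δ := by
    rw [hε, div_mul_eq_mul_div, div_le_iff₀ (by positivity)]
    nlinarith
  set u : G → ℝ := fun d => ∑ j, ((if b j = d then ε else 0) + if -b j = d then ε else 0) with hu
  have hu0 : ∀ d ∈ D, 0 ≤ w d - u d := by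
    intro d hd
    rw [sub_nonneg]
    by_cases h : ∃ j, b j = d ∨ -b j = d
    · obtain ⟨j, hj⟩ := h
      have h1 : δ ≤ w d := by
        rcases hj with rfl | rfl
        · exact (hδb j).1
        · exact (hδb j).2
      refine le_trans ?_ (hεr.trans h1)
      calc u d ≤ ∑ j : ι, (ε + ε) := by
            refine Finset.sum_le_sum fun j _ => add_le_add ?_ ?_ <;> split_ifs <;> linarith
        _ = ε * (2 * r) := by simp [hr]; ring
    · push Not at h
      rw [hu]
      simpa [fun j => (h j).1, fun j => (h j).2] using hw d hd
  have husum : ∑ d ∈ D, single d (u d) =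
      ∑ j, (single (b j) ε + single (-b j) ε : AddMonoidAlgebra ℝ G) := by
    have hs : ∀ (c : G), c ∈ D → ∑ d ∈ D, (single d (if c = d then ε else 0) :
        AddMonoidAlgebra ℝ G) = single c ε := by
      intro c hc
      rw [Finset.sum_eq_single c (fun d _ hd => by simp [hd.symm]) fun h => absurd hc h]
      simp
    have hsingle : ∀ (c : G) (f : ι → ℝ), (single c (∑ j, f j) : AddMonoidAlgebra ℝ G) =
        ∑ j, single c (f j) := fun c f => map_sum (singleAddHom c) f univ
    simp only [hu, hsingle, AddMonoidAlgebra.single_add]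
    rw [Finset.sum_comm]
    refine Finset.sum_congr rfl fun j _ => ?_
    rw [Finset.sum_add_distrib, hs _ (hbD j), hs _ (hbD' j)]
  have husum' : ∑ d ∈ D, u d = r * (2 * ε) := by
    simp only [hu]
    rw [Finset.sum_comm]
    simp [Finset.sum_add_distrib, hbD, hbD', hr]
    ring
  -- Masses of the pieces: 2ε for each two-point part, the rest at `none`.
  set q : Option ι → ℝ := fun i => i.elim (∑ d ∈ D, (w d - u d)) fun _ => 2 * ε with hq
  have hq0 : ∀ i, 0 ≤ q i := by
    rintro (_ | j)
    · exact Finset.sum_nonneg hu0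
    · exact (by positivity : (0 : ℝ) ≤ 2 * ε)
  have hq1 : ∀ j, 0 < q (some j) := fun j => (by positivity : (0 : ℝ) < 2 * ε)
  have hqsum : ∑ i, q i = 1 := by
    rw [Fintype.sum_option]
    simp only [hq, Option.elim, Finset.sum_sub_distrib, hsum, husum']
    simp [hr]
  set F : Option ι → AddMonoidAlgebra ℝ G := fun i =>
    i.elim (∑ d ∈ D, single d (w d - u d)) fun j => single (b j) ε + single (-b j) ε with hF
  have hFsum : ∑ d ∈ D, single d (w d) = ∑ i, F i := by
    rw [Fintype.sum_option]
    simp only [hF, Option.elim, ← husum, ← Finset.sum_add_distrib, ← AddMonoidAlgebra.single_add,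
      sub_add_cancel]
  refine ⟨∏ j : ι, (q (some j))⁻¹, fun n v => ?_⟩
  have hbound : ∀ k : Option ι → ℕ, coeff (∏ i, F i ^ k i) v ∈
      Set.Icc 0 ((∏ i, q i ^ k i) * ∏ j : ι, (Real.sqrt (k (some j) + 1))⁻¹) := by
    intro k
    have := coeff_sum_single_pow_mul_mem_Icc hu0
      (coeff_prod_two_point_pow_mem_Icc hb hε0.le fun j => k (some j)) (k none) v
    rw [Fintype.prod_option, Fintype.prod_option, mul_assoc, ← Finset.prod_mul_distrib]
    exact this
  have hcoeff : coeff ((∑ d ∈ D, single d (w d)) ^ n) v =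
      ∑ k ∈ piAntidiag univ n, (Nat.multinomial univ k : ℝ) * coeff (∏ i, F i ^ k i) v := by
    rw [hFsum, Finset.sum_pow_eq_sum_piAntidiag, coeff_sum, Finsupp.finsetSum_apply]
    refine Finset.sum_congr rfl fun k _ => ?_
    rw [← nsmul_eq_mul, coeff_smul, Finsupp.smul_apply, nsmul_eq_mul]
  set W : (Option ι → ℕ) → ℝ := fun k => (Nat.multinomial univ k : ℝ) * ∏ i, q i ^ k i with hW
  have hW0 : ∀ k, 0 ≤ W k := fun k =>
    mul_nonneg (by positivity) (Finset.prod_nonneg fun i _ => pow_nonneg (hq0 i) _)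
  set R : (Option ι → ℕ) → ℝ := fun k => ∏ j : ι, (Real.sqrt (k (some j) + 1))⁻¹ with hR
  have hRsq : ∀ k, R k ^ 2 = ∏ j : ι, ((k (some j) : ℝ) + 1)⁻¹ := by
    intro k
    rw [hR, ← Finset.prod_pow]
    refine Finset.prod_congr rfl fun j _ => ?_
    rw [inv_pow, Real.sq_sqrt (by positivity)]
  calc (coeff ((∑ d ∈ D, single d (w d)) ^ n) v) ^ 2
      ≤ (∑ k ∈ piAntidiag univ n, W k * R k) ^ 2 := by
        rw [hcoeff]
        refine pow_le_pow_left₀ (Finset.sum_nonneg fun k _ =>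
          mul_nonneg (by positivity) (hbound k).1) (Finset.sum_le_sum fun k _ => ?_) 2
        rw [hW, mul_assoc]
        exact mul_le_mul_of_nonneg_left (hbound k).2 (by positivity)
    -- Cauchy–Schwarz with weights `W` of total mass 1 replaces the inverse square roots by
    -- reciprocals, to which the multinomial bound applies.
    _ ≤ (∑ k ∈ piAntidiag univ n, W k) * ∑ k ∈ piAntidiag univ n, W k * R k ^ 2 := by
        refine Finset.sum_sq_le_sum_mul_sum_of_sq_le_mul _ (fun k _ => hW0 k)
          (fun k _ => mul_nonneg (hW0 k) (sq_nonneg _)) fun k _ => le_of_eq (by ring)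
    _ = ∑ k ∈ piAntidiag univ n, W k * R k ^ 2 := by
        rw [← Finset.sum_pow_eq_sum_piAntidiag, hqsum, one_pow, one_mul]
    _ ≤ _ := by
        simp only [hRsq, hW]
        exact sum_multinomial_mul_prod_inv_le hq0 hq1 hqsum n

end GroupAlgebra

/-! ### From random matrices to coefficients: the union bound -/

section Probability

open AddMonoidAlgebra Finset

variable {𝕜 : Type*} [RCLike 𝕜] {Ω : Type*} [MeasurableSpace Ω] {μ : Measure Ω}

/-- The sum of `#s` independent variables with atoms `w d` at the points `d ∈ D` has the atoms
given by the `#s`-th power in the group algebra. -/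
theorem measureReal_sum_eq [IsProbabilityMeasure μ] {ι : Type*} {Y : ι → Ω → 𝕜}
    (hY : iIndepFun Y μ)
    (hm : ∀ i, Measurable (Y i)) {D : Finset 𝕜} {w : 𝕜 → ℝ}
    (hD : ∀ i, ∀ᵐ ω ∂μ, Y i ω ∈ D) (hw : ∀ i d, μ.real {ω | Y i ω = d} = w d)
    (s : Finset ι) (v : 𝕜) :
    μ.real {ω | ∑ i ∈ s, Y i ω = v} = coeff ((∑ d ∈ D, single d (w d)) ^ #s) v := by
  classical
  induction s using Finset.cons_induction generalizing v with
  | empty =>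
    by_cases h : (0 : 𝕜) = v
    · subst h; simp [one_def]
    · simp [h, one_def]
  | cons i s hi ih =>
    have hms : Measurable (∑ j ∈ s, Y j) := by
      have := Finset.measurable_fun_sum s fun j _ => hm j
      rwa [← Finset.sum_fn] at this
    have h1 : {ω | ∑ j ∈ cons i s hi, Y j ω = v} =ᵐ[μ]
        ⋃ d ∈ D, ((∑ j ∈ s, Y j) ⁻¹' {v - d} ∩ Y i ⁻¹' {d} : Set Ω) := by
      refine Filter.eventuallyEq_set.2 ?_
      filter_upwards [hD i] with ω hω
      simp only [Finset.sum_cons, Set.mem_iUnion, Set.mem_inter_iff, Set.mem_preimage,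
        Set.mem_singleton_iff, Finset.sum_apply, exists_prop]
      constructor
      · intro h
        exact ⟨_, hω, by rw [← h]; ring, rfl⟩
      · rintro ⟨d, -, h2, h3⟩
        rw [h2, h3]; ring
    rw [measureReal_congr h1, measureReal_biUnion_finset, card_cons, pow_succ',
      coeff_sum_single_mul]
    · refine Finset.sum_congr rfl fun d _ => ?_
      have hind := hY.indepFun_finsetSum_of_notMem hm hi
      have := hind.measure_inter_preimage_eq_mul _ _ (measurableSet_singleton (v - d))
        (measurableSet_singleton d)
      rw [Measure.real, this, ENNReal.toReal_mul, mul_comm]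
      congr 1
      · exact hw i d
      · rw [← ih]
        congr 2
        ext ω
        simp
    · intro d _ d' _ hdd
      refine Set.disjoint_left.2 fun ω h2 h3 => hdd ?_
      exact h2.2.symm.trans h3.2
    · exact fun d _ => (hms (measurableSet_singleton _)).inter (hm i (measurableSet_singleton _))

/-- Distinct rows use disjoint blocks of the independent family, so rows can be split off one at a
time. -/
theorem measureReal_forall_row_eq [IsProbabilityMeasure μ] {m n β : Type*} [Fintype n]
    [MeasurableSpace β] {Y : m × n → Ω → β} (hY : iIndepFun Y μ) (hm : ∀ p, Measurable (Y p))
    {A : Set (n → β)} (hA : MeasurableSet A) (s : Finset m) :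
    μ.real {ω | ∀ i ∈ s, (fun j => Y (i, j) ω) ∈ A} =
      ∏ i ∈ s, μ.real {ω | (fun j => Y (i, j) ω) ∈ A} := by
  classical
  induction s using Finset.cons_induction with
  | empty => simp
  | cons i s hi ih =>
    have hdisj : Disjoint (s ×ˢ (univ : Finset n)) ({i} ×ˢ (univ : Finset n)) := by
      rw [Finset.disjoint_left]
      rintro ⟨a, b⟩ h1 h2
      simp only [mem_product, mem_univ, and_true, mem_singleton] at h1 h2
      exact hi (h2 ▸ h1)
    have hind := hY.indepFun_finset _ _ hdisj hm
    have m1 : MeasurableSet {g : (s ×ˢ (univ : Finset n) : Finset (m × n)) → β |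
        ∀ k : s, (fun j => g ⟨(k.1, j), by simp⟩) ∈ A} := by
      rw [Set.ofPred_forall]
      exact MeasurableSet.iInter fun k =>
        (measurable_pi_lambda _ fun j => measurable_pi_apply _) hA
    have m2 : MeasurableSet {g : (({i} : Finset m) ×ˢ (univ : Finset n) : Finset (m × n)) → β |
        (fun j => g ⟨(i, j), by simp⟩) ∈ A} :=
      (measurable_pi_lambda _ fun j => measurable_pi_apply _) hA
    have h := hind.measure_inter_preimage_eq_mul _ _ m1 m2
    rw [Finset.prod_cons, ← ih, mul_comm, Measure.real, Measure.real, Measure.real,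
      ← ENNReal.toReal_mul]
    congr 1
    have e1 : {ω | ∀ k ∈ cons i s hi, (fun j => Y (k, j) ω) ∈ A} =
        {ω | ∀ k ∈ s, (fun j => Y (k, j) ω) ∈ A} ∩ {ω | (fun j => Y (i, j) ω) ∈ A} := by
      ext ω
      simp [and_comm]
    rw [e1]
    convert h using 3 <;> first | rfl | (ext ω; simp)

/-- The probability that the ternary vector with support `s` and positive part `t` lies in the
null space. -/
theorem measureReal_signed_sum_eq_zero [IsProbabilityMeasure μ] {m n : Type*} [Fintype m]
    [Fintype n] [DecidableEq n] {H : Ω → Matrix m n 𝕜}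
    (hH : iIndepFun (fun (p : m × n) (ω : Ω) => H ω p.1 p.2) μ)
    (hm : ∀ i j, Measurable fun ω => H ω i j) {D : Finset 𝕜} (hDneg : ∀ d ∈ D, -d ∈ D)
    {w : 𝕜 → ℝ} (hD : ∀ i j, ∀ᵐ ω ∂μ, H ω i j ∈ D) (hw : ∀ i j d, μ.real {ω | H ω i j = d} = w d)
    (hsymm : ∀ d, w (-d) = w d) (s t : Finset n) :
    μ.real {ω | ∀ i, ∑ j ∈ s, (if j ∈ t then H ω i j else - H ω i j) = 0} =
      (coeff ((∑ d ∈ D, single d (w d)) ^ #s) 0) ^ Fintype.card m := by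
  set A : Set (n → 𝕜) := {g | ∑ j ∈ s, (if j ∈ t then g j else - g j) = 0} with hA
  have hAm : MeasurableSet A := by
    refine measurableSet_eq_fun (Finset.measurable_fun_sum _ fun j _ => ?_) measurable_const
    split_ifs
    · exact measurable_pi_apply j
    · exact (measurable_pi_apply j).neg
  have h1 := measureReal_forall_row_eq hH (fun p => hm p.1 p.2) hAm univ
  have h2 : ∀ i, μ.real {ω | (fun j => H ω i j) ∈ A} =
      coeff ((∑ d ∈ D, single d (w d)) ^ #s) 0 := by
    intro i
    have hrow : iIndepFun (fun j ω => H ω i j) μ :=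
      hH.precomp (g := fun j => (i, j)) fun a b h => (Prod.mk.inj h).2
    -- Fixed sign flips preserve independence and, by symmetry, the law; hence `t` does not affect
    -- the probability.
    have hrow' := hrow.comp (fun j x => if j ∈ t then x else -x) fun j => by
      split_ifs
      · exact measurable_id
      · exact measurable_neg
    refine measureReal_sum_eq hrow' (fun j => ?_) (fun j => ?_) (fun j d => ?_) s 0
    · by_cases h : j ∈ t
      · simpa [Function.comp_def, h] using hm i j
      · simp only [Function.comp_def, h, if_false]
        exact (hm i j).neg
    · filter_upwards [hD i j] with ω hω
      by_cases h : j ∈ t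
      · simpa [h] using hω
      · simpa [h] using hDneg _ hω
    · by_cases h : j ∈ t
      · simpa [h] using hw i j d
      · simpa [h, neg_eq_iff_eq_neg, hsymm] using hw i j (-d)
  simp only [mem_univ, true_imp_iff, h2, Finset.prod_const, Finset.card_univ] at h1
  exact h1

/-- The difference of two inputs has entries 0 or ±(a - b); dividing by a - b leaves a ternary null
vector with support `s` and positive part `t`. -/
theorem exists_signed_sum_eq_zero_of_not_isDetecting {m n : Type*} [Fintype n] [DecidableEq n]
    {H : Matrix m n 𝕜} {a b : 𝕜} (hab : a ≠ b) (h : ¬ IsDetecting {a, b} H) :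
    ∃ s t : Finset n, t ⊆ s ∧ s.Nonempty ∧
      ∀ i, ∑ j ∈ s, (if j ∈ t then H i j else - H i j) = 0 := by
  classical
  simp only [IsDetecting, not_forall] at h
  obtain ⟨x, y, hx, hy, hxy, hne⟩ := h
  refine ⟨univ.filter fun j => x j ≠ y j, univ.filter fun j => x j = a ∧ y j = b, ?_, ?_, fun i => ?_⟩
  · intro j hj
    simp only [mem_filter, mem_univ, true_and] at hj ⊢
    rw [hj.1, hj.2]
    exact hab
  · obtain ⟨j, hj⟩ := Function.ne_iff.1 hne
    exact ⟨j, by simpa using hj⟩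
  · have h1 : ∑ j, H i j * (x j - y j) = 0 := by
      have := congrFun hxy i
      simp only [Matrix.mulVec, dotProduct] at this
      simp only [mul_sub, Finset.sum_sub_distrib, this, sub_self]
    have h2 : ∀ f : n → 𝕜, ∑ j, f j * (x j - y j) = (a - b) *
        ∑ j ∈ univ.filter fun j => x j ≠ y j,
          (if j ∈ univ.filter fun j => x j = a ∧ y j = b then f j else - f j) := by
      intro f
      rw [Finset.mul_sum, Finset.sum_filter]
      refine Finset.sum_congr rfl fun j _ => ?_
      have h3 : x j = a ∨ x j = b := hx j
      have h4 : y j = a ∨ y j = b := hy j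
      rcases h3 with h3 | h3 <;> rcases h4 with h4 | h4 <;>
        simp [h3, h4, hab, hab.symm] <;> ring
    rw [h2 (H i)] at h1
    exact (mul_eq_zero.1 h1).resolve_left (sub_ne_zero.2 hab)

theorem measureReal_not_isDetecting_le [IsProbabilityMeasure μ] {m n : Type*} [Fintype m]
    [Fintype n] {H : Ω → Matrix m n 𝕜} {D : Finset 𝕜} (hDneg : ∀ d ∈ D, -d ∈ D)
    {ψ : Measure 𝕜} (hψ : IsSymmetricNondegenerateOn ψ D) (hH : HasIIDEntries H ψ μ) :
    μ.real {ω | ¬ ∀ a b : 𝕜, a ≠ b → IsDetecting {a, b} (H ω)} ≤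
      ∑ k ∈ Icc 1 (Fintype.card n), ((Fintype.card n).choose k : ℝ) * 2 ^ k *
        (coeff ((∑ d ∈ D, single d (ψ.real {d})) ^ k) 0) ^ Fintype.card m := by
  classical
  have hae : ∀ i j, AEMeasurable (fun ω => H ω i j) μ := fun i j => (hH.hasLaw i j).aemeasurable
  -- The entries are only a.e. measurable; measurable versions change the event by a null set.
  set H' : Ω → Matrix m n 𝕜 := fun ω i j => (hae i j).mk _ ω with hH'
  have hm : ∀ i j, Measurable fun ω => H' ω i j := fun i j => (hae i j).measurable_mk
  have heq : ∀ i j, (fun ω => H ω i j) =ᵐ[μ] fun ω => H' ω i j := fun i j => (hae i j).ae_eq_mk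
  have hind : iIndepFun (fun (p : m × n) (ω : Ω) => H' ω p.1 p.2) μ :=
    hH.indep.congr fun p => heq p.1 p.2
  have hlaw : ∀ i j, μ.map (fun ω => H' ω i j) = ψ := fun i j => by
    rw [← Measure.map_congr (heq i j)]
    exact (hH.hasLaw i j).map_eq
  have hD : ∀ i j, ∀ᵐ ω ∂μ, H' ω i j ∈ D := by
    intro i j
    have := hψ.concentrated
    rw [← hlaw i j, Measure.map_apply (hm i j) D.measurableSet.compl] at this
    exact this
  have hw : ∀ i j d, μ.real {ω | H' ω i j = d} = ψ.real {d} := by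
    intro i j d
    rw [← hlaw i j, map_measureReal_apply (hm i j) (measurableSet_singleton d)]
    rfl
  have hsymm : ∀ d, ψ.real {-d} = ψ.real {d} := fun d => by
    rw [Measure.real, hψ.symmetric, Measure.real]
  have key := measureReal_signed_sum_eq_zero hind hm hDneg hD hw hsymm
  have hall : ∀ᵐ ω ∂μ, H ω = H' ω := by
    have : ∀ᵐ ω ∂μ, ∀ i j, H ω i j = H' ω i j := by
      rw [ae_all_iff]; intro i; rw [ae_all_iff]; exact fun j => heq i j
    filter_upwards [this] with ω hω
    ext i j
    exact hω i j
  have hcongr : {ω | ¬ ∀ a b : 𝕜, a ≠ b → IsDetecting {a, b} (H ω)} =ᵐ[μ]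
      {ω | ¬ ∀ a b : 𝕜, a ≠ b → IsDetecting {a, b} (H' ω)} := by
    refine Filter.eventuallyEq_set.2 ?_
    filter_upwards [hall] with ω hω
    simp only [hω]
  have hsub : {ω | ¬ ∀ a b : 𝕜, a ≠ b → IsDetecting {a, b} (H' ω)} ⊆
      ⋃ s ∈ (univ : Finset n).powerset.erase ∅, ⋃ t ∈ s.powerset,
        {ω | ∀ i, ∑ j ∈ s, (if j ∈ t then H' ω i j else - H' ω i j) = 0} := by
    intro ω h
    simp only [Set.mem_ofPred_eq] at h
    push Not at h
    obtain ⟨a, b, hab, h⟩ := h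
    obtain ⟨s, t, hts, hs, h0⟩ := exists_signed_sum_eq_zero_of_not_isDetecting hab h
    simp only [Set.mem_iUnion, Set.mem_ofPred_eq]
    exact ⟨s, by simp [hs.ne_empty], t, by simpa using hts, h0⟩
  set p : ℕ → ℝ := fun k => coeff ((∑ d ∈ D, single d (ψ.real {d})) ^ k) 0 with hp
  calc _ ≤ μ.real (⋃ s ∈ (univ : Finset n).powerset.erase ∅, ⋃ t ∈ s.powerset,
        {ω | ∀ i, ∑ j ∈ s, (if j ∈ t then H' ω i j else - H' ω i j) = 0} : Set Ω) :=
        (measureReal_congr hcongr).trans_le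
          (measureReal_mono hsub (measure_ne_top _ _))
    _ ≤ ∑ s ∈ (univ : Finset n).powerset.erase ∅, ∑ t ∈ s.powerset,
        μ.real {ω | ∀ i, ∑ j ∈ s, (if j ∈ t then H' ω i j else - H' ω i j) = 0} :=
        (measureReal_biUnion_finset_le _ _).trans <|
          Finset.sum_le_sum fun s _ => measureReal_biUnion_finset_le _ _
    _ = ∑ s ∈ (univ : Finset n).powerset.erase ∅, 2 ^ #s * p #s ^ Fintype.card m := by
        refine Finset.sum_congr rfl fun s _ => ?_
        simp [key, hp]
    _ = ∑ s ∈ (univ : Finset n).powerset,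
          if #s = 0 then 0 else 2 ^ #s * p #s ^ Fintype.card m := by
        rw [← Finset.sum_erase (univ : Finset n).powerset (a := (∅ : Finset n)) (by simp)]
        refine Finset.sum_congr rfl fun s hs => ?_
        rw [if_neg (by simpa using (Finset.mem_erase.1 hs).1)]
    _ = ∑ k ∈ range (Fintype.card n + 1), (Fintype.card n).choose k •
          (if k = 0 then 0 else 2 ^ k * p k ^ Fintype.card m) :=
        Finset.sum_powerset_apply_card (fun k => if k = 0 then 0 else 2 ^ k * p k ^ Fintype.card m)
    _ = _ := by
        rw [Finset.sum_range_succ', if_pos rfl, smul_zero, add_zero,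
          Finset.range_eq_Ico, Finset.sum_Ico_add' (fun k => (Fintype.card n).choose k •
          (if k = 0 then 0 else 2 ^ k * p k ^ Fintype.card m)) 0 (Fintype.card n) 1]
        refine Finset.sum_congr (by ext; simp) fun k hk => ?_
        rw [if_neg (by have := (Finset.mem_Icc.1 hk).1; omega), nsmul_eq_mul, mul_assoc]

end Probability

/-! ### Asymptotics of the union bound -/

section Asymptotics

open Finset Real

theorem eventually_mul_log_rpow_le {a s : ℝ} (hs : 0 < s) (ha : 0 < a) :
    ∀ᶠ K : ℕ in atTop, Real.log K ≤ a * (K : ℝ) ^ s := by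
  have h := ((isLittleO_log_rpow_atTop hs).def ha).natCast_atTop
  filter_upwards [h] with K hK
  rw [Real.norm_of_nonneg (r := (K : ℝ) ^ s) (by positivity)] at hK
  exact (le_abs_self _).trans hK

theorem choose_mul_two_pow_le_three_pow (K k : ℕ) : ((K.choose k : ℝ)) * 2 ^ k ≤ 3 ^ K := by
  rcases le_or_gt k K with h | h
  · have h1 : (3 : ℝ) ^ K = ∑ m ∈ range (K + 1), 2 ^ m * 1 ^ (K - m) * (K.choose m : ℝ) := by
      rw [← add_pow]; norm_num
    rw [h1]
    have := Finset.single_le_sum (f := fun m => (2 : ℝ) ^ m * 1 ^ (K - m) * (K.choose m : ℝ))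
      (fun m _ => by positivity) (Finset.mem_range.2 (Nat.lt_succ_of_le h))
    simpa [mul_comm] using this
  · simp [Nat.choose_eq_zero_of_lt h]

theorem choose_mul_two_pow_le_two_mul_pow (K k : ℕ) :
    ((K.choose k : ℝ)) * 2 ^ k ≤ (2 * K : ℝ) ^ k := by
  have h : (K.choose k : ℝ) ≤ (K : ℝ) ^ k := by exact_mod_cast Nat.choose_le_pow K k
  rw [mul_pow, mul_comm]
  gcongr

variable {p : ℕ → ℝ} {ρ B c : ℝ} {r : ℕ}

/-- Supports are split at size K^σ. Below it, (2K)^k ≤ exp(lN/2), because K^σ log K is negligible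
against K / log K, hence against N; this loses to p_k^N ≤ exp(-lN). Above it, the decay of p_k beats
3^K. -/
theorem exists_eventually_choose_mul_le (hp : ∀ k, 0 ≤ p k) (hρ : ρ < 1)
    (hpρ : ∀ k, 1 ≤ k → p k ≤ ρ) (hpB : ∀ k, p k ^ 2 ≤ B * ((k : ℝ) + 1)⁻¹ ^ r) (hc : 0 < c)
    (hcr : c < r / 2) :
    ∃ κ > 0, ∀ᶠ K : ℕ in atTop, ∀ N : ℕ, K * Real.log 3 ≤ c * N * Real.log K →
      ∀ k ∈ Icc 1 K, (K.choose k : ℝ) * 2 ^ k * p k ^ N ≤ Real.exp (-(κ * N)) := by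
  have hr : (0 : ℝ) < r := by linarith
  obtain ⟨σ, hσ1, hσ2⟩ : ∃ σ, 2 * c / r < σ ∧ σ < 1 :=
    exists_between (by rw [div_lt_one hr]; linarith)
  have hσ0 : 0 < σ := lt_trans (by positivity) hσ1
  have hδ : 0 < σ * r / 2 - c := by
    rw [div_lt_iff₀ hr] at hσ1
    linarith
  set δ := σ * r / 2 - c with hδdef
  obtain ⟨l, hl0, hl⟩ : ∃ l > 0, ∀ k, 1 ≤ k → p k ≤ Real.exp (-l) := by
    -- The maximum with 1/2 keeps the logarithm's argument positive.
    refine ⟨-Real.log (max ρ (1 / 2)), ?_, fun k hk => ?_⟩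
    · exact neg_pos.2 (Real.log_neg (by positivity) (max_lt hρ (by norm_num)))
    · rw [neg_neg, Real.exp_log (by positivity)]
      exact (hpρ k hk).trans (le_max_left _ _)
  obtain ⟨b, hb⟩ : ∃ b, ∀ k, p k ^ 2 ≤ Real.exp (2 * b) * ((k : ℝ) + 1)⁻¹ ^ r := by
    refine ⟨Real.log (max B 1) / 2, fun k => (hpB k).trans ?_⟩
    rw [mul_div_cancel₀ _ two_ne_zero, Real.exp_log (by positivity)]
    gcongr
    exact le_max_left _ _
  refine ⟨min (l / 2) 1, by positivity, ?_⟩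
  have hlog3 : 0 < Real.log 3 := Real.log_pos (by norm_num)
  -- Chosen so that log K ≤ a K^((1-σ)/2) gives 2 K^σ log K ≤ lN/2.
  set a := Real.sqrt (l * Real.log 3 / (4 * c)) with hadef
  have ha : 0 < a := Real.sqrt_pos.2 (by positivity)
  have hasq : a ^ 2 = l * Real.log 3 / (4 * c) := Real.sq_sqrt (by positivity)
  have ev1 := eventually_mul_log_rpow_le (s := (1 - σ) / 2) (by linarith) ha
  -- Makes the exponent δ log K - b at least 1.
  have ev2 : ∀ᶠ K : ℕ in atTop, (1 + b) / δ ≤ Real.log K :=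
    (Real.tendsto_log_atTop.comp tendsto_natCast_atTop_atTop).eventually_ge_atTop _
  filter_upwards [ev1, ev2, eventually_ge_atTop 2] with K h1 h2 h3 N hN k hk
  have hK : (2 : ℝ) ≤ K := by exact_mod_cast h3
  have hK0 : (0 : ℝ) < K := by linarith
  have hL : 0 < Real.log K := Real.log_pos (by linarith)
  set L := Real.log K with hLdef
  have hKσ : (K : ℝ) ^ σ = Real.exp (σ * L) := by
    rw [Real.rpow_def_of_pos hK0, mul_comm]
  have hfin : ∀ x, min (l / 2) 1 ≤ x → Real.exp (-(x * N)) ≤ Real.exp (-(min (l / 2) 1 * N)) := by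
    intro x hx
    gcongr
  have hk1 := (Finset.mem_Icc.1 hk).1
  rcases le_or_gt (k : ℝ) ((K : ℝ) ^ σ) with hkσ | hkσ
  · have e1 : (K : ℝ) ^ σ * (L * L) ≤ l * Real.log 3 / (4 * c) * K := by
      calc (K : ℝ) ^ σ * (L * L)
          ≤ (K : ℝ) ^ σ * ((a * (K : ℝ) ^ ((1 - σ) / 2)) * (a * (K : ℝ) ^ ((1 - σ) / 2))) := by
            gcongr
        _ = a ^ 2 * ((K : ℝ) ^ σ * ((K : ℝ) ^ ((1 - σ) / 2) * (K : ℝ) ^ ((1 - σ) / 2))) := by ring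
        _ = l * Real.log 3 / (4 * c) * K := by
            rw [hasq, ← Real.rpow_add hK0, ← Real.rpow_add hK0]
            congr 1
            rw [show σ + ((1 - σ) / 2 + (1 - σ) / 2) = 1 by ring, Real.rpow_one]
    have e2 : (K : ℝ) ^ σ * (2 * L) ≤ l / 2 * N := by
      have e3 : (K : ℝ) ^ σ * (2 * L) * L ≤ l / 2 * N * L := by
        calc (K : ℝ) ^ σ * (2 * L) * L = 2 * ((K : ℝ) ^ σ * (L * L)) := by ring
          _ ≤ 2 * (l * Real.log 3 / (4 * c) * K) := by linarith
          _ = l / (2 * c) * (K * Real.log 3) := by field_simp; ring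
          _ ≤ l / (2 * c) * (c * N * L) := by gcongr
          _ = l / 2 * N * L := by field_simp
      exact le_of_mul_le_mul_right e3 hL
    have e4 : (2 * K : ℝ) ^ k ≤ Real.exp (l / 2 * N) := by
      have : (2 * K : ℝ) ≤ Real.exp (2 * L) := by
        rw [two_mul L, Real.exp_add, hLdef, Real.exp_log hK0]
        gcongr
      calc (2 * K : ℝ) ^ k ≤ Real.exp (2 * L) ^ k := by gcongr
        _ = Real.exp (k * (2 * L)) := (Real.exp_nat_mul _ _).symm
        _ ≤ Real.exp (l / 2 * N) := by
          refine Real.exp_le_exp.2 (le_trans ?_ e2)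
          gcongr
    calc (K.choose k : ℝ) * 2 ^ k * p k ^ N ≤ Real.exp (l / 2 * N) * Real.exp (-l) ^ N := by
          have := hp k
          gcongr
          · exact (choose_mul_two_pow_le_two_mul_pow K k).trans e4
          · exact hl k hk1
      _ = Real.exp (-(l / 2 * N)) := by
          rw [← Real.exp_nat_mul, ← Real.exp_add]
          congr 1
          ring
      _ ≤ _ := hfin _ (min_le_left _ _)
  · have e1 : p k ≤ Real.exp (b - r * σ * L / 2) := by
      apply le_of_sq_le_sq _ (Real.exp_nonneg _)
      calc p k ^ 2 ≤ Real.exp (2 * b) * ((k : ℝ) + 1)⁻¹ ^ r := hb k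
        _ ≤ Real.exp (2 * b) * (Real.exp (σ * L))⁻¹ ^ r := by
          have : Real.exp (σ * L) ≤ k + 1 := by rw [← hKσ]; linarith
          gcongr
        _ = Real.exp (b - r * σ * L / 2) ^ 2 := by
          rw [← Real.exp_neg, ← Real.exp_nat_mul, ← Real.exp_nat_mul, ← Real.exp_add]
          congr 1
          push_cast
          ring
    have e2 : (3 : ℝ) ^ K ≤ Real.exp (c * N * L) := by
      calc (3 : ℝ) ^ K = Real.exp (K * Real.log 3) := by
            rw [Real.exp_nat_mul, Real.exp_log (by norm_num)]
        _ ≤ _ := Real.exp_le_exp.2 hN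
    calc (K.choose k : ℝ) * 2 ^ k * p k ^ N
        ≤ Real.exp (c * N * L) * Real.exp (b - r * σ * L / 2) ^ N := by
          have := hp k
          gcongr
          exact (choose_mul_two_pow_le_three_pow K k).trans e2
      _ = Real.exp (-((δ * L - b) * N)) := by
          rw [← Real.exp_nat_mul, ← Real.exp_add, hδdef]
          congr 1
          ring
      _ ≤ _ := hfin _ ((min_le_right _ _).trans (by
          rw [div_le_iff₀ hδ] at h2
          linarith))

/-- The sum is at most K exp(-κN), and K ≤ N² turns this into any polynomial decay in both K and N;
the stated form is summable over all pairs. -/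
theorem eventually_sum_choose_mul_le (hp : ∀ k, 0 ≤ p k) (hρ : ρ < 1)
    (hpρ : ∀ k, 1 ≤ k → p k ≤ ρ) (hpB : ∀ k, p k ^ 2 ≤ B * ((k : ℝ) + 1)⁻¹ ^ r) (hc : 0 < c)
    (hcr : c < r / 2) :
    ∀ᶠ K : ℕ in atTop, ∀ N : ℕ, K * Real.log 3 ≤ c * N * Real.log K →
      ∑ k ∈ Icc 1 K, (K.choose k : ℝ) * 2 ^ k * p k ^ N ≤
        (((K : ℝ) + 1) ^ 2)⁻¹ * (((N : ℝ) + 1) ^ 2)⁻¹ := by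
  obtain ⟨κ, hκ, h⟩ := exists_eventually_choose_mul_le hp hρ hpρ hpB hc hcr
  have hlog3 : 0 < Real.log 3 := Real.log_pos (by norm_num)
  have ev1 := eventually_mul_log_rpow_le (s := 1 / 2) (a := Real.log 3 / c) (by norm_num)
    (by positivity)
  -- The power 8 pays for K (K+1)² (N+1)² when K and K+1 are at most (N+1)².
  have ev2 : ∀ᶠ N : ℕ in atTop, ((N : ℝ) + 1) ^ 8 * Real.exp (-(κ * N)) ≤ 1 := by
    have t := (tendsto_pow_mul_exp_neg_atTop_nhds_zero 8).comp
      ((tendsto_natCast_atTop_atTop (R := ℝ)).const_mul_atTop hκ)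
    have t2 := t.const_mul ((2 / κ) ^ 8)
    rw [mul_zero] at t2
    filter_upwards [t2.eventually_le_const one_pos, eventually_ge_atTop 1] with N hN h1
    refine le_trans ?_ hN
    have h1' : (1 : ℝ) ≤ N := by exact_mod_cast h1
    calc ((N : ℝ) + 1) ^ 8 * Real.exp (-(κ * N)) ≤ (2 * N) ^ 8 * Real.exp (-(κ * N)) := by
          gcongr
          linarith
      _ = _ := by
          simp only [Function.comp]
          field_simp
  obtain ⟨N0, hN0⟩ := eventually_atTop.1 ev2
  filter_upwards [h, ev1, eventually_ge_atTop (max 2 (N0 ^ 2))] with K hK h1 h2 N hN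
  have hK2 : 2 ≤ K := (le_max_left _ _).trans h2
  have hK0 : (0 : ℝ) < K := by positivity
  have hsq : Real.sqrt K ≤ N := by
    rw [← Real.sqrt_eq_rpow] at h1
    have hs : 0 < Real.sqrt K := Real.sqrt_pos.2 hK0
    have : Real.sqrt K * (Real.sqrt K * Real.log 3) ≤ N * (Real.sqrt K * Real.log 3) := by
      calc Real.sqrt K * (Real.sqrt K * Real.log 3) = K * Real.log 3 := by
            rw [← mul_assoc, Real.mul_self_sqrt hK0.le]
        _ ≤ c * N * Real.log K := hN
        _ ≤ c * N * (Real.log 3 / c * Real.sqrt K) := by gcongr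
        _ = N * (Real.sqrt K * Real.log 3) := by field_simp
    exact le_of_mul_le_mul_right this (by positivity)
  have hKN : (K : ℝ) ≤ (N : ℝ) ^ 2 := (Real.sqrt_le_left (by positivity)).1 hsq
  -- `N` is arbitrary here, so its size must come from N0² ≤ K ≤ N².
  have hNN0 : N0 ≤ N := by
    have h3 : (N0 ^ 2 : ℕ) ≤ N ^ 2 := by
      have : K ≤ N ^ 2 := by exact_mod_cast hKN
      exact ((le_max_right _ _).trans h2).trans this
    exact (Nat.pow_le_pow_iff_left two_ne_zero).1 h3
  calc _ ≤ ∑ k ∈ Icc 1 K, Real.exp (-(κ * N)) := Finset.sum_le_sum fun k hk => hK N hN k hk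
    _ = K * Real.exp (-(κ * N)) := by simp
    _ ≤ _ := by
      rw [← mul_inv, ← one_div, le_div_iff₀ (by positivity)]
      refine le_trans ?_ (hN0 N hNN0)
      have hn : (0 : ℝ) ≤ N := by positivity
      have hK1 : (K : ℝ) ≤ (N + 1) ^ 2 := by nlinarith
      have hK3 : (K : ℝ) + 1 ≤ (N + 1) ^ 2 := by nlinarith
      calc K * Real.exp (-(κ * N)) * (((K : ℝ) + 1) ^ 2 * ((N : ℝ) + 1) ^ 2)
          ≤ ((N : ℝ) + 1) ^ 2 * Real.exp (-(κ * N)) *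
            ((((N : ℝ) + 1) ^ 2) ^ 2 * ((N : ℝ) + 1) ^ 2) := by gcongr
        _ = _ := by ring

end Asymptotics

/-! ### Application to the entry distribution -/

section Detecting

open AddMonoidAlgebra Finset

variable {𝕜 : Type*} [RCLike 𝕜] {D : Finset 𝕜} {ψ : Measure 𝕜}

namespace IsSymmetricNondegenerateOn

theorem sum_atoms_eq_one (hψ : IsSymmetricNondegenerateOn ψ D) :
    ∑ d ∈ D, ψ.real {d} = 1 := by
  have := hψ.isProbabilityMeasure
  rw [sum_measureReal_singleton, Measure.real,
    (prob_compl_eq_zero_iff D.measurableSet).1 hψ.concentrated, ENNReal.toReal_one]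

theorem exists_measureReal_singleton_le (hψ : IsSymmetricNondegenerateOn ψ D) :
    ∃ ρ, 0 ≤ ρ ∧ ρ < 1 ∧ ∀ d ∈ D, ψ.real {d} ≤ ρ := by
  have := hψ.isProbabilityMeasure
  have hne : D.Nonempty := by
    rw [Finset.nonempty_iff_ne_empty]
    rintro rfl
    simpa using hψ.sum_atoms_eq_one
  obtain ⟨d, hd, hmax⟩ := D.exists_max_image (fun d => ψ.real {d}) hne
  refine ⟨ψ.real {d}, measureReal_nonneg, lt_of_le_of_ne measureReal_le_one fun h => ?_, hmax⟩
  apply hψ.not_point_mass d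
  rw [Measure.real, ENNReal.toReal_eq_one_iff] at h
  exact h

/-- A rational basis of the span can be chosen among points of positive mass; by non-degeneracy it
has `rationalRank D` elements, and by symmetry their negatives have positive mass too. -/
theorem exists_sq_coeff_le (hψ : IsSymmetricNondegenerateOn ψ D) (hD : ∀ d ∈ D, -d ∈ D) :
    ∃ B : ℝ, ∀ (k : ℕ) (v : 𝕜), (coeff ((∑ d ∈ D, single d (ψ.real {d})) ^ k) v) ^ 2 ≤
      B * ((k : ℝ) + 1)⁻¹ ^ rationalRank D := by
  have := hψ.isProbabilityMeasure
  have : Module.Finite ℚ (Submodule.span ℚ {d : 𝕜 | d ∈ D ∧ ψ {d} ≠ 0}) :=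
    Module.Finite.span_of_finite ℚ (D.finite_toSet.subset fun d hd => hd.1)
  obtain ⟨b, hb, -, hli⟩ :=
    Submodule.exists_fun_fin_finrank_span_eq ℚ {d : 𝕜 | d ∈ D ∧ ψ {d} ≠ 0}
  have hpos : ∀ d, ψ {d} ≠ 0 → 0 < ψ.real {d} := fun d hd =>
    ENNReal.toReal_pos hd (measure_ne_top _ _)
  obtain ⟨B, hB⟩ := exists_sq_coeff_sum_single_pow_le hli (D := D) (w := fun d => ψ.real {d})
    (fun _ _ => measureReal_nonneg) hψ.sum_atoms_eq_one (fun j => (hb j).1)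
    (fun j => hD _ (hb j).1) (fun j => hpos _ (hb j).2)
    (fun j => hpos _ (by rw [hψ.symmetric]; exact (hb j).2))
  refine ⟨B, fun k v => (hB k v).trans_eq ?_⟩
  rw [Fintype.card_fin, rationalRank, hψ.span_atoms]

end IsSymmetricNondegenerateOn

theorem eventually_measureReal_not_isDetecting_le (hD : ∀ d ∈ D, -d ∈ D)
    (hψ : IsSymmetricNondegenerateOn ψ D)
    {Ω : Type*} [MeasurableSpace Ω] (μ : Measure Ω) [IsProbabilityMeasure μ]
    (K N : ℕ → ℕ) (hK : Tendsto K atTop atTop) (hN : Tendsto N atTop atTop)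
    (c : ℝ) (hc : c < (rationalRank D : ℝ) / 2)
    (hζ : ∀ᶠ n in atTop, (K n : ℝ) / ((N n : ℝ) * Real.logb 3 (K n : ℝ)) ≤ c)
    (H : ∀ n, Ω → Matrix (Fin (N n)) (Fin (K n)) 𝕜)
    (hH : ∀ n, HasIIDEntries (H n) ψ μ) :
    ∀ᶠ n in atTop, μ.real {ω | ¬ ∀ a b : 𝕜, a ≠ b → IsDetecting {a, b} (H n ω)} ≤
      (((K n : ℝ) + 1) ^ 2)⁻¹ * (((N n : ℝ) + 1) ^ 2)⁻¹ := by
  have hlog3 : 0 < Real.log 3 := Real.log_pos (by norm_num)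
  have hζ' : ∀ᶠ n in atTop, 0 < c ∧ (K n : ℝ) * Real.log 3 ≤ c * N n * Real.log (K n) := by
    filter_upwards [hζ, hK.eventually_ge_atTop 2, hN.eventually_ge_atTop 1] with n h1 h2 h3
    have hk : (2 : ℝ) ≤ K n := by exact_mod_cast h2
    have hn : (1 : ℝ) ≤ N n := by exact_mod_cast h3
    have hL : 0 < Real.log (K n) := Real.log_pos (by linarith)
    have hpos : 0 < (N n : ℝ) * Real.logb 3 (K n) := by
      rw [Real.logb]; positivity
    refine ⟨lt_of_lt_of_le (by positivity) h1, ?_⟩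
    rw [div_le_iff₀ hpos, Real.logb, ← mul_div_assoc, ← mul_div_assoc, le_div_iff₀ hlog3] at h1
    linarith
  -- Positivity of `c` is forced, since the ratio it bounds is eventually positive.
  have hc0 : 0 < c := by
    obtain ⟨n, hn⟩ := hζ'.exists
    exact hn.1
  obtain ⟨ρ, hρ0, hρ1, hρ⟩ := hψ.exists_measureReal_singleton_le
  obtain ⟨B, hB⟩ := hψ.exists_sq_coeff_le hD
  have hw : ∀ d ∈ D, 0 ≤ ψ.real {d} := fun _ _ => measureReal_nonneg
  have hnonneg : ∀ k : ℕ, 0 ≤ coeff ((∑ d ∈ D, single d (ψ.real {d})) ^ k) 0 := by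
    intro k
    have := (coeff_sum_single_pow_mul_mem_Icc (g := 1) (M := 1) hw ?_ k 0).1
    · simpa using this
    · intro v
      rw [one_def, coeff_single, Finsupp.single_apply]
      split_ifs <;> simp
  have key := eventually_sum_choose_mul_le hnonneg hρ1
    (fun k hk => coeff_sum_single_pow_le hw hψ.sum_atoms_eq_one hρ0 hρ hk 0)
    (fun k => hB k 0) hc0 hc
  filter_upwards [hK.eventually key, hζ'] with n h1 h2
  have h3 := measureReal_not_isDetecting_le hD hψ (hH n)
  simp only [Fintype.card_fin] at h3
  exact h3.trans (h1 _ h2.2)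

end Detecting

theorem theorem4 {𝕜 : Type*} [RCLike 𝕜] (D : Finset 𝕜) (hD : ∀ d ∈ D, -d ∈ D)
    (ψ : Measure 𝕜) (hψ : IsSymmetricNondegenerateOn ψ D)
    {Ω : Type*} [MeasurableSpace Ω] (μ : Measure Ω) [IsProbabilityMeasure μ]
    (K N : ℕ → ℕ) (hK : Tendsto K atTop atTop) (hN : Tendsto N atTop atTop)
    (c : ℝ) (hc : c < (rationalRank D : ℝ) / 2)
    (hζ : ∀ᶠ n in atTop, (K n : ℝ) / ((N n : ℝ) * Real.logb 3 (K n : ℝ)) ≤ c)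
    (H : ∀ n, Ω → Matrix (Fin (N n)) (Fin (K n)) 𝕜)
    (hH : ∀ n, HasIIDEntries (H n) ψ μ) :
    Tendsto (fun n => μ {ω | ∀ a b : 𝕜, a ≠ b → IsDetecting {a, b} (H n ω)}) atTop (𝓝 1) ∧
    (Function.Injective (fun n => (K n, N n)) →
      ∀ᵐ ω ∂μ, ∀ᶠ n in atTop, ∀ a b : 𝕜, a ≠ b → IsDetecting {a, b} (H n ω)) := by
  have hbound := eventually_measureReal_not_isDetecting_le hD hψ μ K N hK hN c hc hζ H hH
  set g : ℕ × ℕ → ℝ := fun q => (((q.1 : ℝ) + 1) ^ 2)⁻¹ * (((q.2 : ℝ) + 1) ^ 2)⁻¹ with hg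
  have hg0 : ∀ q, 0 ≤ g q := fun q => by positivity
  have hbound' : ∀ᶠ n in atTop, μ {ω | ¬ ∀ a b : 𝕜, a ≠ b → IsDetecting {a, b} (H n ω)} ≤
      ENNReal.ofReal (g (K n, N n)) := by
    filter_upwards [hbound] with n hn
    rw [← ofReal_measureReal]
    exact ENNReal.ofReal_le_ofReal hn
  constructor
  · have hfac : ∀ {u : ℕ → ℕ}, Tendsto u atTop atTop →
        Tendsto (fun n => (((u n : ℝ) + 1) ^ 2)⁻¹) atTop (𝓝 0) := fun hu =>
      tendsto_inv_atTop_zero.comp ((tendsto_pow_atTop two_ne_zero).comp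
        (tendsto_atTop_add_const_right _ _ (tendsto_natCast_atTop_atTop.comp hu)))
    have hlim : Tendsto (fun n => g (K n, N n)) atTop (𝓝 0) := by
      simpa using (hfac hK).mul (hfac hN)
    have hlim' : Tendsto (fun n => 1 - ENNReal.ofReal (g (K n, N n))) atTop (𝓝 1) := by
      have := ENNReal.Tendsto.sub (tendsto_const_nhds (x := (1 : ENNReal)))
        (ENNReal.tendsto_ofReal hlim) (Or.inl ENNReal.one_ne_top)
      simpa using this
    refine tendsto_of_tendsto_of_tendsto_of_le_of_le' hlim' tendsto_const_nhds ?_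
      (Eventually.of_forall fun n => prob_le_one)
    filter_upwards [hbound'] with n hn
    rw [tsub_le_iff_right]
    -- Subadditivity instead of complements avoids measurability of the event.
    calc (1 : ENNReal) = μ Set.univ := measure_univ.symm
      _ ≤ μ ({ω | ∀ a b : 𝕜, a ≠ b → IsDetecting {a, b} (H n ω)} ∪
          {ω | ¬ ∀ a b : 𝕜, a ≠ b → IsDetecting {a, b} (H n ω)}) :=
          measure_mono fun ω _ => em _
      _ ≤ _ := (measure_union_le _ _).trans (by gcongr)
  · intro hinj
    obtain ⟨n0, hn0⟩ := eventually_atTop.1 hbound'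
    set s : ℕ → Set Ω := fun n =>
      {ω | ¬ ∀ a b : 𝕜, a ≠ b → IsDetecting {a, b} (H (n + n0) ω)} with hs
    have hsum1 : Summable fun n : ℕ => (((n : ℝ) + 1) ^ 2)⁻¹ := by
      have := (summable_nat_add_iff 1).2 (Real.summable_nat_pow_inv.2 (one_lt_two))
      simpa using this
    have hsum : Summable g := hsum1.mul_of_nonneg hsum1 (fun _ => by positivity)
      fun _ => by positivity
    -- Distinct sizes make this dominated by a subseries of the sum of `g` over all pairs;
    -- Borel–Cantelli then needs no independence between different n.
    have hfin : ∑' n, μ (s n) ≠ ⊤ := by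
      refine ne_top_of_le_ne_top hsum.tsum_ofReal_ne_top ?_
      calc ∑' n, μ (s n) ≤ ∑' n, ENNReal.ofReal (g (K (n + n0), N (n + n0))) :=
            ENNReal.tsum_le_tsum fun n => hn0 _ (Nat.le_add_left _ _)
        _ ≤ ∑' q, ENNReal.ofReal (g q) :=
            ENNReal.tsum_comp_le_tsum_of_injective
              (hinj.comp (add_left_injective n0)) fun q => ENNReal.ofReal (g q)
    filter_upwards [ae_eventually_notMem hfin] with ω hω
    obtain ⟨m, hm⟩ := eventually_atTop.1 hω
    refine eventually_atTop.2 ⟨m + n0, fun n hn => ?_⟩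
    have h := hm (n - n0) (by omega)
    simp only [hs, Set.mem_ofPred_eq, not_not] at h
    rwa [Nat.sub_add_cancel (by omega)] at h
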